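/- Let $H$ be a separable infinite-dimensional complex Hilbert space, $K(H)$ the algebra of compact operators on $H$ and $K(H)^+$ the set of positive ones. For $a \in K(H)^+$ let $\lambda_1(a) \ge \lambda_2(a) \ge \cdots$ be the list of the nonzero eigenvalues of $a$ in decreasing order, counted with multiplicity, continued by zeros if $a$ has finite rank. Let $\alpha : \{0,1,2,\dots\} \to [0,\infty)$ be an increasing (not necessarily strictly) function with $\alpha(0) = 0$ and $\alpha(1) > 0$, and put $c_i = \alpha(i) - \alpha(i-1)$ for $i \ge 1$. Define $\varphi_\alpha : K(H)^+ \to [0,\infty]$ by $$\varphi_\alpha(a) = \sum_{i=1}^\infty (\lambda_i(a) - \lambda_{i+1}(a))\,\alpha(i),$$ and for $a \in K(H)$ put $|||a|||_\alpha = \varphi_\alpha(|a|) \in [0,\infty]$, where $|a| = (a^*a)^{1/2}$. Then the following conditions are equivalent: 1. $\alpha$ is concave, in the sense that $\frac{\alpha(i+1) + \alpha(i-1)}{2} \le \alpha(i)$ for all $i = 1, 2, 3, \dots$; 2. $(c_i)_{i \ge 1}$ is decreasing: $c_1 \ge c_2 \ge c_3 \ge \cdots$; 3. $|||\cdot|||_\alpha$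 satisfies the triangle inequality: $|||a+b|||_\alpha \le |||a|||_\alpha + |||b|||_\alpha$ in $[0,\infty]$ for all $a, b \in K(H)$. -/

import Mathlib

open scoped ENNReal NNReal

noncomputable section

namespace ChoquetTrace

variable {H : Type*} [NormedAddCommGroup H] [InnerProductSpace ℂ H] [CompleteSpace H]

/-- The linear span of the eigenspaces of `a` for real eigenvalues `s ≥ t`.  Its dimension
is the number of eigenvalues of `a` that are at least `t`, counted with multiplicity. -/
def upperEigenspace (a : H →L[ℂ] H) (t : ℝ) : Submodule ℂ H :=
  ⨆ s : ℝ, ⨆ _ : t ≤ s, Module.End.eigenspace (a : H →ₗ[ℂ] H) (s : ℂ)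

/-- The eigenvalue sequence of a positive compact operator `a`: `eigenvalueSeq a k` is
`λ_{k+1}(a)`, the `(k+1)`-st largest eigenvalue of `a` counted with multiplicity, the list being
continued by zeros when `a` has finite rank.  It is the largest `t ≥ 0` such that `a` has at least
`k + 1` eigenvalues (with multiplicity) in `[t, ∞)`. -/
def eigenvalueSeq (a : H →L[ℂ] H) (k : ℕ) : ℝ :=
  sSup {t : ℝ | 0 ≤ t ∧ ((k + 1 : ℕ) : Cardinal) ≤ Module.rank ℂ (upperEigenspace a t)}

/-- The non-linear trace of Choquet type associated with `α`, on positive compact operators: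
`φ_α(a) = ∑_{i ≥ 1} (λ_i(a) - λ_{i+1}(a)) α(i)`, with values in `[0, ∞]`
(the term of index `k` below is the one with `i = k + 1`). -/
def choquetTrace (α : ℕ → ℝ≥0) (a : H →L[ℂ] H) : ℝ≥0∞ :=
  ∑' k : ℕ, ENNReal.ofReal (eigenvalueSeq a k - eigenvalueSeq a (k + 1)) * (α (k + 1) : ℝ≥0∞)

/-- `|||a|||_α = φ_α(|a|)`, where `|a| = (a* a)^{1/2}`, for compact `a`. -/
def choquetNorm (α : ℕ → ℝ≥0) (a : H →L[ℂ] H) : ℝ≥0∞ :=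
  choquetTrace α (CFC.abs a)

/-- Midpoint concavity: `(α(i+1) + α(i-1)) / 2 ≤ α(i)` for `i = 1, 2, 3, …`. -/
def IsConcaveSeq (α : ℕ → ℝ≥0) : Prop :=
  ∀ i : ℕ, 1 ≤ i → ((α (i + 1) : ℝ) + (α (i - 1) : ℝ)) / 2 ≤ (α i : ℝ)

/-- The increments `c_i = α(i) - α(i-1)`, meant for `i ≥ 1`. -/
def increment (α : ℕ → ℝ≥0) (i : ℕ) : ℝ :=
  (α i : ℝ) - (α (i - 1) : ℝ)

end ChoquetTrace

end

/-!
Write `c_i = α(i) - α(i - 1)`.  Abel summation turns `|||a|||_α` into `∑ c_i s_i(a)`, where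
`s_i(a)` are the singular values.  By Ky Fan's maximum principle `s_1(a) + ⋯ + s_n(a)` is the
largest value of `Re ∑_{k ≤ n} ⟨u_k, a v_k⟩` over families of `n` pairwise orthogonal vectors of
norm at most one, so it is subadditive in `a`, and decreasing weights `c_i ≥ 0` preserve
inequalities between partial sums.

Conversely, let `p` and `q` be the projections onto the spans of `e_0, …, e_n` and of
`e_0, …, e_{n-1}, e_{n+1}`.  Then `p + q` is also the sum of nested projections of ranks `n` and
`n + 2`, on which `φ_α` is additive, and `φ_α` takes the value `α(k)` on a projection of rank `k`.
Thus the triangle inequality for `p` and `q` reads `α(n) + α(n + 2) ≤ 2 α(n + 1)`.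
-/

namespace ChoquetTrace

section CompactOperators

theorem isCompactOperator_of_norm_apply_le {𝕜 E F G : Type*} [NontriviallyNormedField 𝕜]
    [NormedAddCommGroup E] [NormedSpace 𝕜 E] [NormedAddCommGroup F] [NormedSpace 𝕜 F]
    [NormedAddCommGroup G] [NormedSpace 𝕜 G] [CompleteSpace G] {a : E →L[𝕜] F} {b : E →L[𝕜] G}
    (ha : IsCompactOperator a) (hba : ∀ x, ‖b x‖ ≤ ‖a x‖) : IsCompactOperator b := by
  have ha_ball : TotallyBounded (a '' Metric.ball 0 1) :=
    (IsCompactOperator.isCompact_closure_image_ball (f := (a : E →ₗ[𝕜] F)) ha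
      1).totallyBounded.subset subset_closure
  suffices TotallyBounded (b '' Metric.ball 0 1) from
    (isCompactOperator_iff_isCompact_closure_image_ball (b : E →ₗ[𝕜] G) one_pos).2
      (this.closure.isCompact_of_isClosed isClosed_closure)
  refine Metric.totallyBounded_iff.2 fun ε hε => ?_
  obtain ⟨net, hnet, hnet_fin, hcover⟩ := Metric.finite_approx_of_totallyBounded ha_ball ε hε
  obtain ⟨s, -, hs_fin, rfl⟩ := Set.exists_subset_image_finite_and.1 ⟨net, hnet, hnet_fin, rfl⟩
  refine ⟨b '' s, hs_fin.image b, ?_⟩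
  rintro _ ⟨x, hx, rfl⟩
  obtain ⟨_, ⟨z, hz, rfl⟩, hxz⟩ := Set.mem_iUnion₂.1 (hcover ⟨x, hx, rfl⟩)
  refine Set.mem_iUnion₂.2 ⟨b z, ⟨z, hz, rfl⟩, ?_⟩
  rw [Metric.mem_ball, dist_eq_norm, ← map_sub] at hxz ⊢
  exact (hba _).trans_lt hxz

theorem isCompactOperator_rankOne {𝕜 E F : Type*} [RCLike 𝕜] [NormedAddCommGroup E]
    [NormedSpace 𝕜 E] [NormedAddCommGroup F] [InnerProductSpace 𝕜 F] (x : E) (y : F) :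
    IsCompactOperator (InnerProductSpace.rankOne 𝕜 x y) := by
  have hid : IsCompactOperator (ContinuousLinearMap.id 𝕜 𝕜) :=
    isCompactOperator_id_iff_locallyCompactSpace.2 inferInstance
  exact (hid.comp_clm (innerSL 𝕜 y)).clm_comp (ContinuousLinearMap.toSpanSingleton 𝕜 x)

variable {H : Type*} [NormedAddCommGroup H] [InnerProductSpace ℂ H] [CompleteSpace H]

theorem exists_norm_eq_one_apply_eq_norm_smul [Nontrivial H] {A : H →L[ℂ] H}
    (hA : IsCompactOperator A) (hpos : A.IsPositive) :
    ∃ e : H, ‖e‖ = 1 ∧ A e = (‖A‖ : ℂ) • e := by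
  rcases eq_or_ne A 0 with rfl | hA0
  · obtain ⟨e, he⟩ := exists_norm_eq H zero_le_one
    exact ⟨e, he, by simp⟩
  have hnorm : (‖A‖ : ℂ) ≠ 0 := by simpa using hA0
  have hspec : (‖A‖ : ℂ) ∈ spectrum ℂ A :=
    spectrum.algebraMap_mem ℂ
      (CStarAlgebra.norm_mem_spectrum_of_nonneg ((A.nonneg_iff_isPositive).2 hpos))
  obtain ⟨x, hx⟩ := ((hA.hasEigenvalue_iff_mem_spectrum hnorm).2 hspec).exists_hasEigenvector
  refine ⟨((‖x‖⁻¹ : ℝ) : ℂ) • x, by simp [norm_smul, hx.2], ?_⟩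
  have hAx : A x = (‖A‖ : ℂ) • x := hx.apply_eq_smul
  rw [map_smul, hAx, smul_comm]

theorem exists_eigenvector_mem_orthogonal (hH : ¬ FiniteDimensional ℂ H) {A : H →L[ℂ] H}
    (hA : IsCompactOperator A) (hpos : A.IsPositive) {V : Submodule ℂ H} [FiniteDimensional ℂ V]
    (hV : V ∈ Module.End.invtSubmodule (A : H →ₗ[ℂ] H)) :
    ∃ e ∈ Vᗮ, ∃ μ : ℝ, ‖e‖ = 1 ∧ 0 ≤ μ ∧ A e = (μ : ℂ) • e ∧ ∀ w ∈ Vᗮ, ‖A w‖ ≤ μ * ‖w‖ := by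
  have hVperp : ∀ x ∈ Vᗮ, A x ∈ Vᗮ :=
    hpos.isSymmetric.orthogonalComplement_mem_invtSubmodule hV
  have hVperp_ne_bot : Vᗮ ≠ ⊥ := fun h => by
    rw [Submodule.orthogonal_eq_bot_iff] at h
    subst h
    exact hH (Submodule.topEquiv (R := ℂ) (M := H)).finiteDimensional
  have : Nontrivial Vᗮ := Submodule.nontrivial_iff_ne_bot.2 hVperp_ne_bot
  set B : Vᗮ →L[ℂ] Vᗮ := A.restrict hVperp
  have hB : IsCompactOperator B := IsCompactOperator.restrict' (f := (A : H →ₗ[ℂ] H)) hA hVperp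
  have hBpos : B.IsPositive :=
    ⟨fun x y => hpos.isSymmetric x y, fun x => hpos.re_inner_nonneg_left (x : H)⟩
  obtain ⟨e, he, hBe⟩ := exists_norm_eq_one_apply_eq_norm_smul hB hBpos
  exact ⟨e, e.2, ‖B‖, he, norm_nonneg B, congrArg Subtype.val hBe,
    fun w hw => B.le_opNorm ⟨w, hw⟩⟩

end CompactOperators

section OrthogonalFamilies

variable {𝕜 E F ι κ : Type*} [RCLike 𝕜] [NormedAddCommGroup E] [InnerProductSpace 𝕜 E]
  [NormedAddCommGroup F] [InnerProductSpace 𝕜 F]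

theorem exists_orthonormal_nat (hE : ¬ FiniteDimensional 𝕜 E) : ∃ e : ℕ → E, Orthonormal 𝕜 e := by
  let b := Module.Basis.ofVectorSpace 𝕜 E
  have : Infinite (Module.Basis.ofVectorSpaceIndex 𝕜 E) :=
    not_finite_iff_infinite.1 fun _ => hE (Module.Finite.of_basis b)
  exact ⟨_, InnerProductSpace.gramSchmidtNormed_orthonormal
    (b.linearIndependent.comp _ (Infinite.natEmbedding _).injective)⟩

theorem norm_sum_sq_of_pairwise_inner_eq_zero {u : ι → E}
    (hu : Pairwise fun i j => inner 𝕜 (u i) (u j) = 0) (s : Finset ι) :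
    ‖∑ i ∈ s, u i‖ ^ 2 = ∑ i ∈ s, ‖u i‖ ^ 2 := by
  have hfamily : OrthogonalFamily 𝕜 (fun i => 𝕜 ∙ u i) fun i => (𝕜 ∙ u i).subtypeₗᵢ :=
    OrthogonalFamily.of_pairwise fun i j hij => Submodule.isOrtho_span.2 (by simpa using hu hij)
  exact hfamily.norm_sum (fun i => ⟨u i, Submodule.mem_span_singleton_self _⟩) s

theorem inner_sub_sum_inner_smul_eq_zero {e : ι → E} (he : Orthonormal 𝕜 e) {s : Finset ι} {j : ι}
    (hj : j ∈ s) (x : E) : inner 𝕜 (e j) (x - ∑ i ∈ s, inner 𝕜 (e i) x • e i) = 0 := by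
  rw [inner_sub_right, he.inner_right_sum _ hj, sub_self]

theorem mem_orthogonal_of_succ_eq_sup_span {V : ℕ → Submodule 𝕜 E} {v : ℕ → E} (h0 : V 0 = ⊥)
    (hsucc : ∀ n, V (n + 1) = V n ⊔ 𝕜 ∙ v n) {n : ℕ} {w : E} (hw : ∀ j < n, inner 𝕜 (v j) w = 0) :
    w ∈ (V n)ᗮ := by
  induction n with
  | zero => simp [h0]
  | succ n ih =>
    rw [hsucc, ← Submodule.inf_orthogonal]
    exact ⟨ih fun j hj => hw j (hj.trans n.lt_succ_self),
      Submodule.mem_orthogonal_singleton_iff_inner_right.2 (hw n n.lt_succ_self)⟩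

/-- Pairwise orthogonal vectors of norm at most one.  Unlike an orthonormal family, such a family
may contain zeros; the image of an orthonormal family under a partial isometry that diagonalizes
with it is of this kind. -/
structure IsSubOrthonormal (𝕜 : Type*) [RCLike 𝕜] {E : Type*} [NormedAddCommGroup E]
    [InnerProductSpace 𝕜 E] {ι : Type*} (u : ι → E) : Prop where
  norm_le_one : ∀ i, ‖u i‖ ≤ 1
  inner_eq_zero : Pairwise fun i j => inner 𝕜 (u i) (u j) = 0

namespace IsSubOrthonormal

variable {u : ι → E}

theorem of_orthonormal {e : ι → E} (he : Orthonormal 𝕜 e) : IsSubOrthonormal 𝕜 e :=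
  ⟨fun i => (he.1 i).le, he.2⟩

theorem norm_sum_smul_sq_le (hu : IsSubOrthonormal 𝕜 u) (s : Finset ι) (c : ι → 𝕜) :
    ‖∑ i ∈ s, c i • u i‖ ^ 2 ≤ ∑ i ∈ s, ‖c i‖ ^ 2 := by
  have horth : Pairwise fun i j => inner 𝕜 (c i • u i) (c j • u j) = 0 := fun i j hij => by
    simp [inner_smul_left, inner_smul_right, hu.inner_eq_zero hij]
  rw [norm_sum_sq_of_pairwise_inner_eq_zero horth]
  gcongr with i
  rw [norm_smul]
  exact mul_le_of_le_one_right (norm_nonneg _) (hu.norm_le_one i)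

theorem sum_norm_inner_sq_le (hu : IsSubOrthonormal 𝕜 u) (s : Finset ι) (x : E) :
    ∑ i ∈ s, ‖inner 𝕜 (u i) x‖ ^ 2 ≤ ‖x‖ ^ 2 := by
  set y := ∑ i ∈ s, inner 𝕜 (u i) x • u i with hy
  have hy_norm : ‖y‖ ^ 2 ≤ ∑ i ∈ s, ‖inner 𝕜 (u i) x‖ ^ 2 := hu.norm_sum_smul_sq_le s _
  have hxy : RCLike.re (inner 𝕜 x y) = ∑ i ∈ s, ‖inner 𝕜 (u i) x‖ ^ 2 := by
    rw [hy, inner_sum, map_sum]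
    refine Finset.sum_congr rfl fun i _ => ?_
    rw [inner_smul_right, ← inner_conj_symm x (u i), RCLike.mul_conj]
    norm_cast
  have hsub := norm_sub_sq (𝕜 := 𝕜) x y
  rw [hxy] at hsub
  linarith [sq_nonneg ‖x - y‖]

theorem re_sum_inner_mul_inner_le_one {u : κ → F} {v : κ → E} (hu : IsSubOrthonormal 𝕜 u)
    (hv : IsSubOrthonormal 𝕜 v) {f : F} {e : E} (hf : ‖f‖ ≤ 1) (he : ‖e‖ ≤ 1) (s : Finset κ) :
    RCLike.re (∑ k ∈ s, inner 𝕜 e (v k) * inner 𝕜 (u k) f) ≤ 1 := by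
  have hterm (k : κ) : RCLike.re (inner 𝕜 e (v k) * inner 𝕜 (u k) f) ≤
      (‖inner 𝕜 (v k) e‖ ^ 2 + ‖inner 𝕜 (u k) f‖ ^ 2) / 2 := by
    refine (RCLike.re_le_norm _).trans ?_
    rw [norm_mul, norm_inner_symm e]
    linarith [two_mul_le_add_sq ‖inner 𝕜 (v k) e‖ ‖inner 𝕜 (u k) f‖]
  calc RCLike.re (∑ k ∈ s, inner 𝕜 e (v k) * inner 𝕜 (u k) f)
      ≤ ∑ k ∈ s, (‖inner 𝕜 (v k) e‖ ^ 2 + ‖inner 𝕜 (u k) f‖ ^ 2) / 2 := by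
        rw [map_sum]
        exact Finset.sum_le_sum fun k _ => hterm k
    _ = (∑ k ∈ s, ‖inner 𝕜 (v k) e‖ ^ 2 + ∑ k ∈ s, ‖inner 𝕜 (u k) f‖ ^ 2) / 2 := by
        rw [← Finset.sum_div, Finset.sum_add_distrib]
    _ ≤ (1 + 1) / 2 := by
        gcongr
        · exact (hv.sum_norm_inner_sq_le s e).trans (pow_le_one₀ (norm_nonneg _) he)
        · exact (hu.sum_norm_inner_sq_le s f).trans (pow_le_one₀ (norm_nonneg _) hf)
    _ = 1 := by norm_num

theorem re_sum_inner_apply_le {u : κ → F} {v : κ → E} (hu : IsSubOrthonormal 𝕜 u)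
    (hv : IsSubOrthonormal 𝕜 v) {e : ι → E} {f : ι → F} (he : ∀ j, ‖e j‖ ≤ 1)
    (hf : ∀ j, ‖f j‖ ≤ 1) {t : Finset ι} {σ : ι → ℝ} (hσ : ∀ j ∈ t, 0 ≤ σ j) {r : ℝ} (hr : 0 ≤ r)
    {T : E → F} (hT : ∀ x, ‖T x - ∑ j ∈ t, ((σ j : 𝕜) * inner 𝕜 (e j) x) • f j‖ ≤ r * ‖x‖)
    (s : Finset κ) :
    RCLike.re (∑ k ∈ s, inner 𝕜 (u k) (T (v k))) ≤ ∑ j ∈ t, σ j + s.card * r := by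
  set R : E → F := fun x => T x - ∑ j ∈ t, ((σ j : 𝕜) * inner 𝕜 (e j) x) • f j
  have hR (k : κ) : RCLike.re (inner 𝕜 (u k) (R (v k))) ≤ r := calc
    RCLike.re (inner 𝕜 (u k) (R (v k))) ≤ ‖u k‖ * ‖R (v k)‖ := re_inner_le_norm _ _
    _ ≤ 1 * (r * 1) := by
      gcongr
      · exact hu.norm_le_one k
      · exact (hT _).trans (mul_le_mul_of_nonneg_left (hv.norm_le_one k) hr)
    _ = r := by ring
  have hsplit : ∑ k ∈ s, inner 𝕜 (u k) (T (v k)) =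
      ∑ j ∈ t, (σ j : 𝕜) * ∑ k ∈ s, inner 𝕜 (e j) (v k) * inner 𝕜 (u k) (f j) +
        ∑ k ∈ s, inner 𝕜 (u k) (R (v k)) := by
    simp only [Finset.mul_sum]
    rw [Finset.sum_comm, ← Finset.sum_add_distrib]
    refine Finset.sum_congr rfl fun k _ => ?_
    simp only [R, inner_sub_right, inner_sum, inner_smul_right, mul_assoc, add_sub_cancel]
  rw [hsplit, map_add, map_sum, map_sum, ← nsmul_eq_mul]
  refine add_le_add (Finset.sum_le_sum fun j hj => ?_)
    (Finset.sum_le_card_nsmul _ _ _ fun k _ => hR k)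
  rw [RCLike.re_ofReal_mul]
  exact mul_le_of_le_one_right (hσ j hj) (hu.re_sum_inner_mul_inner_le_one hv (hf j) (he j) s)

end IsSubOrthonormal

end OrthogonalFamilies

section EigenSequences

variable {H : Type*} [NormedAddCommGroup H] [InnerProductSpace ℂ H]

/-- `e` is an orthonormal sequence of eigenvectors of `A` with eigenvalues `μ`, chosen greedily:
`norm_le` says that `μ n` is the norm of `A` on the orthogonal complement of `e 0, …, e (n - 1)`.
For a positive compact `A` this makes `μ` its list of eigenvalues in decreasing order. -/
structure IsEigenSequence (A : H →L[ℂ] H) (e : ℕ → H) (μ : ℕ → ℝ) : Prop where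
  orthonormal : Orthonormal ℂ e
  nonneg : ∀ n, 0 ≤ μ n
  apply_eq : ∀ n, A (e n) = (μ n : ℂ) • e n
  norm_le : ∀ n w, (∀ j < n, inner ℂ (e j) w = 0) → ‖A w‖ ≤ μ n * ‖w‖

theorem span_singleton_mem_invtSubmodule {A : H →L[ℂ] H} {x : H} {c : ℂ} (hx : A x = c • x) :
    (ℂ ∙ x) ∈ Module.End.invtSubmodule (A : H →ₗ[ℂ] H) := by
  rw [Module.End.mem_invtSubmodule, Submodule.span_singleton_le_iff_mem, Submodule.mem_comap]
  exact Submodule.mem_span_singleton.2 ⟨c, hx.symm⟩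

theorem exists_isEigenSequence [CompleteSpace H] (hH : ¬ FiniteDimensional ℂ H) {A : H →L[ℂ] H}
    (hA : IsCompactOperator A) (hpos : A.IsPositive) : ∃ e μ, IsEigenSequence A e μ := by
  have step : ∀ V : Submodule ℂ H,
      FiniteDimensional ℂ V ∧ V ∈ Module.End.invtSubmodule (A : H →ₗ[ℂ] H) →
      ∃ x ∈ Vᗮ, ∃ μ : ℝ, ‖x‖ = 1 ∧ 0 ≤ μ ∧ A x = (μ : ℂ) • x ∧ ∀ w ∈ Vᗮ, ‖A w‖ ≤ μ * ‖w‖ :=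
    fun V ⟨_, hV⟩ => exists_eigenvector_mem_orthogonal hH hA hpos hV
  choose! pick hpick val hnorm hval hpick_eq hle using step
  let V : ℕ → Submodule ℂ H := fun n => (fun W => W ⊔ ℂ ∙ pick W)^[n] ⊥
  have hV_succ (n : ℕ) : V (n + 1) = V n ⊔ ℂ ∙ pick (V n) :=
    Function.iterate_succ_apply' _ n ⊥
  have hV (n : ℕ) :
      FiniteDimensional ℂ (V n) ∧ V n ∈ Module.End.invtSubmodule (A : H →ₗ[ℂ] H) := by
    induction n with
    | zero =>
      exact ⟨inferInstanceAs (FiniteDimensional ℂ (⊥ : Submodule ℂ H)),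
        Module.End.invtSubmodule.bot_mem _⟩
    | succ n ih =>
      have := ih.1
      rw [hV_succ]
      exact ⟨inferInstance, Sublattice.sup_mem ih.2
        (span_singleton_mem_invtSubmodule (hpick_eq _ ih))⟩
  have hV_mono : Monotone V := monotone_nat_of_le_succ fun n => hV_succ n ▸ le_sup_left
  have hpick_mem (n : ℕ) : pick (V n) ∈ V (n + 1) :=
    hV_succ n ▸ Submodule.mem_sup_right (Submodule.mem_span_singleton_self _)
  have hlt {i j : ℕ} (hij : i < j) : inner ℂ (pick (V i)) (pick (V j)) = 0 :=
    hpick _ (hV j) _ (hV_mono hij (hpick_mem i))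
  exact ⟨fun n => pick (V n), fun n => val (V n),
    ⟨fun n => hnorm _ (hV n), fun i j hij => hij.lt_or_gt.elim hlt
      fun hji => inner_eq_zero_symm.1 (hlt hji)⟩,
    fun n => hval _ (hV n), fun n => hpick_eq _ (hV n),
    fun n w hw => hle _ (hV n) w (mem_orthogonal_of_succ_eq_sup_span rfl hV_succ hw)⟩

namespace IsEigenSequence

variable {A B : H →L[ℂ] H} {e : ℕ → H} {μ ν : ℕ → ℝ}

theorem add (hA : IsEigenSequence A e μ) (hB : IsEigenSequence B e ν) :
    IsEigenSequence (A + B) e (μ + ν) where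
  orthonormal := hA.orthonormal
  nonneg n := add_nonneg (hA.nonneg n) (hB.nonneg n)
  apply_eq n := by
    simp only [add_apply, Pi.add_apply, hA.apply_eq, hB.apply_eq, Complex.ofReal_add, add_smul]
  norm_le n w hw := calc
    ‖A w + B w‖ ≤ μ n * ‖w‖ + ν n * ‖w‖ := norm_add_le_of_le (hA.norm_le n w hw) (hB.norm_le n w hw)
    _ = (μ + ν) n * ‖w‖ := (add_mul _ _ _).symm

theorem norm_apply (h : IsEigenSequence A e μ) (n : ℕ) : ‖A (e n)‖ = μ n := by
  rw [h.apply_eq, norm_smul, h.orthonormal.1, mul_one, Complex.norm_of_nonneg (h.nonneg n)]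

theorem antitone (h : IsEigenSequence A e μ) : Antitone μ := by
  refine antitone_nat_of_succ_le fun n => ?_
  simpa only [h.norm_apply, h.orthonormal.1, mul_one] using
    h.norm_le n (e (n + 1)) fun j hj => h.orthonormal.2 (hj.trans n.lt_succ_self).ne

theorem le_norm_sub (h : IsEigenSequence A e μ) {m n : ℕ} (hmn : m ≠ n) :
    μ m ≤ ‖A (e m) - A (e n)‖ := by
  have horth : inner ℂ (A (e m)) (A (e n)) = 0 := by
    rw [h.apply_eq, h.apply_eq, inner_smul_left, inner_smul_right, h.orthonormal.2 hmn, mul_zero,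
      mul_zero]
  refine le_of_sq_le_sq ?_ (norm_nonneg _)
  rw [norm_sub_sq (𝕜 := ℂ), horth, h.norm_apply, h.norm_apply, map_zero, mul_zero, sub_zero]
  exact le_add_of_nonneg_right (sq_nonneg _)

theorem tendsto_zero (h : IsEigenSequence A e μ) (hA : IsCompactOperator A) :
    Filter.Tendsto μ Filter.atTop (nhds 0) := by
  have hbdd : BddBelow (Set.range μ) := ⟨0, Set.forall_mem_range.2 h.nonneg⟩
  have hlim := tendsto_atTop_ciInf h.antitone hbdd
  suffices (⨅ n, μ n) = 0 by rwa [this] at hlim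
  obtain ⟨K, hK, hAK⟩ :=
    IsCompactOperator.image_closedBall_subset_compact (f := (A : H →ₗ[ℂ] H)) hA 1
  obtain ⟨x, -, φ, hφ, hx⟩ := hK.tendsto_subseq (x := fun n => A (e n)) fun n =>
    hAK ⟨e n, by simp [h.orthonormal.1 n], rfl⟩
  refine le_antisymm (le_of_forall_pos_lt_add fun ε hε => ?_) (le_ciInf h.nonneg)
  obtain ⟨N, hN⟩ := Metric.cauchySeq_iff'.1 hx.cauchySeq ε hε
  calc ⨅ n, μ n ≤ μ (φ (N + 1)) := ciInf_le hbdd _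
    _ ≤ ‖A (e (φ (N + 1))) - A (e (φ N))‖ := h.le_norm_sub (hφ N.lt_succ_self).ne'
    _ < ε := by simpa only [dist_eq_norm, Function.comp_apply] using hN (N + 1) N.le_succ
    _ = 0 + ε := (zero_add ε).symm

theorem inner_apply_eq (h : IsEigenSequence A e μ) (hA : (A : H →ₗ[ℂ] H).IsSymmetric) (j : ℕ)
    (x : H) : inner ℂ (e j) (A x) = μ j * inner ℂ (e j) x := calc
  inner ℂ (e j) (A x) = inner ℂ (A (e j)) x := (hA (e j) x).symm
  _ = μ j * inner ℂ (e j) x := by rw [h.apply_eq, inner_smul_left, Complex.conj_ofReal]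

theorem le_rank_upperEigenspace (h : IsEigenSequence A e μ) {k : ℕ} {t : ℝ} (ht : t ≤ μ k) :
    ((k + 1 : ℕ) : Cardinal) ≤ Module.rank ℂ (upperEigenspace A t) := by
  have hmem (i : Fin (k + 1)) : e i ∈ upperEigenspace A t :=
    Submodule.mem_iSup_of_mem (μ i) <| Submodule.mem_iSup_of_mem
      (ht.trans (h.antitone i.is_le)) <| Module.End.mem_eigenspace_iff.2 (h.apply_eq i)
  have hli : LinearIndependent ℂ fun i : Fin (k + 1) => (⟨e i, hmem i⟩ : upperEigenspace A t) :=
    .of_comp (upperEigenspace A t).subtype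
      (h.orthonormal.linearIndependent.comp Fin.val Fin.val_injective)
  simpa using hli.cardinal_lift_le_rank

theorem upperEigenspace_le_span (h : IsEigenSequence A e μ) (hA : (A : H →ₗ[ℂ] H).IsSymmetric)
    {k : ℕ} {t : ℝ} (ht : μ k < t) :
    upperEigenspace A t ≤ Submodule.span ℂ (Set.range fun i : Fin k => e i) := by
  refine iSup₂_le fun s hs x hx => ?_
  have hAx : A x = (s : ℂ) • x := Module.End.mem_eigenspace_iff.1 hx
  set p := ∑ j ∈ Finset.range k, inner ℂ (e j) x • e j with hp
  have hp_mem : p ∈ Submodule.span ℂ (Set.range fun i : Fin k => e i) :=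
    Submodule.sum_mem _ fun j hj => Submodule.smul_mem _ _
      (Submodule.subset_span ⟨⟨j, Finset.mem_range.1 hj⟩, rfl⟩)
  have hAp : A p = (s : ℂ) • p := by
    rw [hp, map_sum, Finset.smul_sum]
    refine Finset.sum_congr rfl fun j _ => ?_
    have heig := h.inner_apply_eq hA j x
    rw [hAx, inner_smul_right] at heig
    rw [map_smul, h.apply_eq, smul_smul, smul_smul, heig, mul_comm]
  have hAsub : A (x - p) = (s : ℂ) • (x - p) := by rw [map_sub, hAx, hAp, smul_sub]
  have hle : s * ‖x - p‖ ≤ μ k * ‖x - p‖ := calc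
    s * ‖x - p‖ = ‖A (x - p)‖ := by
      rw [hAsub, norm_smul, Complex.norm_of_nonneg ((h.nonneg k).trans (ht.le.trans hs))]
    _ ≤ μ k * ‖x - p‖ := h.norm_le k _ fun j hj =>
      inner_sub_sum_inner_smul_eq_zero h.orthonormal (Finset.mem_range.2 hj) x
  have hxp : x = p := by
    by_contra hne
    exact (ht.trans_le hs).not_ge
      (le_of_mul_le_mul_right hle (norm_pos_iff.2 (sub_ne_zero.2 hne)))
  exact hxp ▸ hp_mem

theorem eigenvalueSeq_eq (h : IsEigenSequence A e μ) (hA : (A : H →ₗ[ℂ] H).IsSymmetric) :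
    eigenvalueSeq A = μ := by
  ext k
  refine IsGreatest.csSup_eq ⟨⟨h.nonneg k, h.le_rank_upperEigenspace le_rfl⟩, fun t ht => ?_⟩
  by_contra! hlt
  have hfin : FiniteDimensional ℂ (Submodule.span ℂ (Set.range fun i : Fin k => e i)) :=
    .span_of_finite ℂ (Set.finite_range _)
  have hrank : ((k + 1 : ℕ) : Cardinal) ≤ (k : ℕ) := calc
    ((k + 1 : ℕ) : Cardinal) ≤ Module.rank ℂ (upperEigenspace A t) := ht.2
    _ ≤ Module.rank ℂ (Submodule.span ℂ (Set.range fun i : Fin k => e i)) :=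
      Submodule.rank_mono (h.upperEigenspace_le_span hA hlt)
    _ = (Module.finrank ℂ (Submodule.span ℂ (Set.range fun i : Fin k => e i)) : ℕ) :=
      (Module.finrank_eq_rank ..).symm
    _ ≤ (k : ℕ) := Nat.cast_le.2 ((finrank_range_le_card _).trans_eq (Fintype.card_fin k))
  exact (Nat.cast_le.1 hrank).not_gt k.lt_succ_self

theorem norm_smul_sum_add_apply_sub_le (h : IsEigenSequence A e μ)
    (hA : (A : H →ₗ[ℂ] H).IsSymmetric) (n : ℕ) (x : H) :
    ‖(μ n : ℂ) • (∑ j ∈ Finset.range n, inner ℂ (e j) x • e j) +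
      A (x - ∑ j ∈ Finset.range n, inner ℂ (e j) x • e j)‖ ≤ μ n * ‖x‖ := by
  set p := ∑ j ∈ Finset.range n, inner ℂ (e j) x • e j with hp
  have horth {j : ℕ} (hj : j ∈ Finset.range n) : inner ℂ (e j) (x - p) = 0 :=
    inner_sub_sum_inner_smul_eq_zero h.orthonormal hj x
  have hp_orth : inner ℂ p (x - p) = 0 := by
    rw [hp, sum_inner]
    exact Finset.sum_eq_zero fun j hj => by rw [inner_smul_left, horth hj, mul_zero]
  have hAp_orth : inner ℂ ((μ n : ℂ) • p) (A (x - p)) = 0 := by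
    rw [inner_smul_left, hp, sum_inner, Finset.sum_eq_zero, mul_zero]
    intro j hj
    rw [inner_smul_left, h.inner_apply_eq hA, horth hj, mul_zero, mul_zero]
  have hA_sub : ‖A (x - p)‖ ≤ μ n * ‖x - p‖ :=
    h.norm_le n _ fun j hj => horth (Finset.mem_range.2 hj)
  refine le_of_sq_le_sq ?_ (mul_nonneg (h.nonneg n) (norm_nonneg x))
  calc ‖(μ n : ℂ) • p + A (x - p)‖ ^ 2 = (μ n * ‖p‖) ^ 2 + ‖A (x - p)‖ ^ 2 := by
        rw [norm_add_sq (𝕜 := ℂ), hAp_orth, norm_smul, Complex.norm_of_nonneg (h.nonneg n),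
          map_zero, mul_zero, add_zero]
    _ ≤ (μ n * ‖p‖) ^ 2 + (μ n * ‖x - p‖) ^ 2 := by gcongr
    _ = μ n ^ 2 * ‖p + (x - p)‖ ^ 2 := by
        rw [norm_add_sq (𝕜 := ℂ) p, hp_orth, map_zero]
        ring
    _ = (μ n * ‖x‖) ^ 2 := by rw [add_sub_cancel, mul_pow]

theorem norm_apply_sub_sum_le (h : IsEigenSequence A e μ) (hA : (A : H →ₗ[ℂ] H).IsSymmetric)
    (n : ℕ) (x : H) :
    ‖A x - ∑ j ∈ Finset.range n, (((μ j - μ n : ℝ) : ℂ) * inner ℂ (e j) x) • e j‖ ≤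
      μ n * ‖x‖ := by
  convert h.norm_smul_sum_add_apply_sub_le hA n x using 2
  rw [map_sub, map_sum, Finset.smul_sum, ← add_sub_assoc, add_comm, add_sub_assoc, sub_eq_add_neg,
    ← Finset.sum_neg_distrib, ← Finset.sum_sub_distrib]
  refine congrArg (A x + ·) (Finset.sum_congr rfl fun j _ => ?_)
  rw [map_smul, h.apply_eq, Complex.ofReal_sub]
  module

end IsEigenSequence

end EigenSequences

section InitialProjections

variable {H : Type*} [NormedAddCommGroup H] [InnerProductSpace ℂ H]

/-- For orthonormal `e`, the orthogonal projection onto the span of `e 0, …, e (n - 1)`. -/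
noncomputable def initialProjection (e : ℕ → H) (n : ℕ) : H →L[ℂ] H :=
  ∑ j ∈ Finset.range n, InnerProductSpace.rankOne ℂ (e j) (e j)

theorem initialProjection_apply (e : ℕ → H) (n : ℕ) (x : H) :
    initialProjection e n x = ∑ j ∈ Finset.range n, inner ℂ (e j) x • e j := by
  simp [initialProjection, sum_apply]

theorem isCompactOperator_initialProjection (e : ℕ → H) (n : ℕ) :
    IsCompactOperator (initialProjection e n) :=
  (compactOperator (RingHom.id ℂ) H H).sum_mem fun j _ => isCompactOperator_rankOne (e j) (e j)

theorem isPositive_initialProjection (e : ℕ → H) (n : ℕ) : (initialProjection e n).IsPositive :=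
  ContinuousLinearMap.isPositive_sum _ fun j _ => InnerProductSpace.isPositive_rankOne_self (e j)

theorem norm_initialProjection_apply_le {e : ℕ → H} (he : Orthonormal ℂ e) (n : ℕ) (x : H) :
    ‖initialProjection e n x‖ ≤ ‖x‖ := by
  have he' : IsSubOrthonormal ℂ e := .of_orthonormal he
  rw [initialProjection_apply]
  exact le_of_sq_le_sq
    ((he'.norm_sum_smul_sq_le _ _).trans (he'.sum_norm_inner_sq_le _ x)) (norm_nonneg x)

theorem isEigenSequence_initialProjection {e : ℕ → H} (he : Orthonormal ℂ e) (n : ℕ) :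
    IsEigenSequence (initialProjection e n) e ((Set.Iio n).indicator 1) where
  orthonormal := he
  nonneg := Set.indicator_nonneg fun _ _ => zero_le_one
  apply_eq m := by
    simp [initialProjection_apply, orthonormal_iff_ite.1 he, Set.indicator_apply]
  norm_le m w hw := by
    rcases lt_or_ge m n with hmn | hnm
    · simpa [hmn] using norm_initialProjection_apply_le he n w
    · rw [initialProjection_apply, Finset.sum_eq_zero fun j hj => by
        rw [hw j ((Finset.mem_range.1 hj).trans_le hnm), zero_smul]]
      simp [hnm.not_gt]

theorem initialProjection_add_initialProjection_swap (e : ℕ → H) (n : ℕ) :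
    initialProjection e (n + 1) + initialProjection (e ∘ Equiv.swap n (n + 1)) (n + 1) =
      initialProjection e n + initialProjection e (n + 2) := by
  have hfix : initialProjection (e ∘ Equiv.swap n (n + 1)) n = initialProjection e n :=
    Finset.sum_congr rfl fun j hj => by
      have hjn := Finset.mem_range.1 hj
      rw [Function.comp_apply, Equiv.swap_apply_of_ne_of_ne hjn.ne (hjn.trans n.lt_succ_self).ne]
  have hsucc (f : ℕ → H) (m : ℕ) : initialProjection f (m + 1) =
      initialProjection f m + InnerProductSpace.rankOne ℂ (f m) (f m) :=
    Finset.sum_range_succ _ m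
  rw [hsucc, hsucc, hsucc e (n + 1), hsucc e n, hfix, Function.comp_apply, Equiv.swap_apply_left]
  abel

end InitialProjections

section SingularValues

variable {H : Type*} [NormedAddCommGroup H] [InnerProductSpace ℂ H] [CompleteSpace H]

theorem isPositive_abs (a : H →L[ℂ] H) : (CFC.abs a).IsPositive :=
  (ContinuousLinearMap.nonneg_iff_isPositive _).1 (CFC.abs_nonneg a)

theorem inner_abs_apply_abs_apply (a : H →L[ℂ] H) (x y : H) :
    inner ℂ (CFC.abs a x) (CFC.abs a y) = inner ℂ (a x) (a y) := calc
  inner ℂ (CFC.abs a x) (CFC.abs a y) = inner ℂ x ((CFC.abs a * CFC.abs a) y) :=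
    (isPositive_abs a).inner_left_eq_inner_right x _
  _ = inner ℂ (a x) (a y) := by
    rw [CFC.abs_mul_abs]
    exact ContinuousLinearMap.adjoint_inner_right a x (a y)

theorem norm_abs_apply (a : H →L[ℂ] H) (x : H) : ‖CFC.abs a x‖ = ‖a x‖ := by
  rw [norm_eq_sqrt_re_inner (𝕜 := ℂ), norm_eq_sqrt_re_inner (𝕜 := ℂ), inner_abs_apply_abs_apply]

theorem isCompactOperator_abs {a : H →L[ℂ] H} (ha : IsCompactOperator a) :
    IsCompactOperator (CFC.abs a : H →L[ℂ] H) :=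
  isCompactOperator_of_norm_apply_le (b := CFC.abs a) ha fun x => (norm_abs_apply a x).le

/-- The images `a e_j / μ_j` of the `e_j` under the partial isometry of the polar decomposition
of `a`, when `|a| e_j = μ_j e_j`.  The value is `0` when `μ_j = 0`, and then also `a e_j = 0`. -/
noncomputable def polarSeq (a : H →L[ℂ] H) (e : ℕ → H) (μ : ℕ → ℝ) (j : ℕ) : H :=
  (μ j : ℂ)⁻¹ • a (e j)

namespace IsEigenSequence

variable {a b : H →L[ℂ] H} {e f g : ℕ → H} {μ ν ρ : ℕ → ℝ}

theorem inner_map_map (h : IsEigenSequence (CFC.abs a) e μ) (i j : ℕ) :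
    inner ℂ (a (e i)) (a (e j)) = μ i * μ j * inner ℂ (e i) (e j) := by
  rw [← inner_abs_apply_abs_apply, h.apply_eq, h.apply_eq, inner_smul_left, inner_smul_right,
    Complex.conj_ofReal, mul_assoc]

theorem isSubOrthonormal_polarSeq (h : IsEigenSequence (CFC.abs a) e μ) :
    IsSubOrthonormal ℂ (polarSeq a e μ) where
  norm_le_one i := by
    rw [polarSeq, norm_smul, ← norm_abs_apply, h.norm_apply, norm_inv,
      Complex.norm_of_nonneg (h.nonneg i)]
    exact inv_mul_le_one
  inner_eq_zero i j hij := by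
    simp only [polarSeq, inner_smul_left, inner_smul_right, h.inner_map_map,
      h.orthonormal.2 hij, mul_zero]

theorem re_sum_inner_polarSeq (h : IsEigenSequence (CFC.abs a) e μ) (s : Finset ℕ) :
    RCLike.re (∑ k ∈ s, inner ℂ (polarSeq a e μ k) (a (e k))) = ∑ k ∈ s, μ k := by
  rw [map_sum]
  refine Finset.sum_congr rfl fun k _ => ?_
  rw [polarSeq, inner_smul_left, h.inner_map_map,
    inner_self_eq_one_of_norm_eq_one (h.orthonormal.1 k), map_inv₀, Complex.conj_ofReal, mul_one,
    ← mul_assoc]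
  norm_cast
  rw [inv_mul_mul_self]
  exact Complex.ofReal_re _

-- Cutting the singular values down to `μ n` leaves an operator of norm at most `μ n`.  This finite
-- form of the singular value decomposition avoids any infinite expansion of `a`.
theorem norm_apply_sub_sum_polarSeq_le (h : IsEigenSequence (CFC.abs a) e μ) (n : ℕ) (x : H) :
    ‖a x - ∑ j ∈ Finset.range n,
      (((μ j - μ n : ℝ) : ℂ) * inner ℂ (e j) x) • polarSeq a e μ j‖ ≤ μ n * ‖x‖ := by
  set c : ℕ → ℂ := fun j => ((μ j - μ n) / μ j : ℝ) * inner ℂ (e j) x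
  have ha_sum : a (∑ j ∈ Finset.range n, c j • e j) = ∑ j ∈ Finset.range n,
      (((μ j - μ n : ℝ) : ℂ) * inner ℂ (e j) x) • polarSeq a e μ j := by
    rw [map_sum]
    refine Finset.sum_congr rfl fun j _ => ?_
    rw [map_smul, polarSeq, smul_smul]
    congr 1
    simp only [c]
    push_cast
    ring
  have habs_sum : CFC.abs a (∑ j ∈ Finset.range n, c j • e j) = ∑ j ∈ Finset.range n,
      (((μ j - μ n : ℝ) : ℂ) * inner ℂ (e j) x) • e j := by
    rw [map_sum]
    refine Finset.sum_congr rfl fun j hj => ?_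
    have hzero : μ j = 0 → μ j - μ n = 0 := fun hμj => by
      linarith [h.nonneg n, h.antitone (Finset.mem_range.1 hj).le]
    rw [map_smul, h.apply_eq, smul_smul, mul_right_comm, ← Complex.ofReal_mul,
      div_mul_cancel_of_imp hzero]
  rw [← ha_sum, ← map_sub, ← norm_abs_apply, map_sub, habs_sum]
  exact h.norm_apply_sub_sum_le (isPositive_abs a).isSymmetric n x

theorem re_sum_inner_apply_le (h : IsEigenSequence (CFC.abs a) e μ) {u v : ℕ → H}
    (hu : IsSubOrthonormal ℂ u) (hv : IsSubOrthonormal ℂ v) (n : ℕ) :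
    RCLike.re (∑ k ∈ Finset.range n, inner ℂ (u k) (a (v k))) ≤ ∑ k ∈ Finset.range n, μ k := calc
  RCLike.re (∑ k ∈ Finset.range n, inner ℂ (u k) (a (v k)))
      ≤ ∑ j ∈ Finset.range n, (μ j - μ n) + (Finset.range n).card * μ n :=
    hu.re_sum_inner_apply_le hv (fun j => (h.orthonormal.1 j).le)
      h.isSubOrthonormal_polarSeq.norm_le_one
      (fun _ hj => sub_nonneg.2 (h.antitone (Finset.mem_range.1 hj).le)) (h.nonneg n)
      (h.norm_apply_sub_sum_polarSeq_le n) _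
  _ = ∑ k ∈ Finset.range n, μ k := by
    rw [Finset.sum_sub_distrib, Finset.sum_const, nsmul_eq_mul, sub_add_cancel]

theorem sum_range_le_add (hab : IsEigenSequence (CFC.abs (a + b)) e μ)
    (ha : IsEigenSequence (CFC.abs a) f ν) (hb : IsEigenSequence (CFC.abs b) g ρ) (n : ℕ) :
    ∑ k ∈ Finset.range n, μ k ≤ ∑ k ∈ Finset.range n, (ν + ρ) k := by
  have hu := hab.isSubOrthonormal_polarSeq
  have hv : IsSubOrthonormal ℂ e := .of_orthonormal hab.orthonormal
  simp only [← hab.re_sum_inner_polarSeq, add_apply, inner_add_right, Pi.add_apply,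
    Finset.sum_add_distrib, map_add]
  exact add_le_add (ha.re_sum_inner_apply_le hu hv n) (hb.re_sum_inner_apply_le hu hv n)

end IsEigenSequence

end SingularValues

section Sequences

/-- The discrete Choquet integral `∑ (μ_k - μ_{k+1}) α(k + 1)` of a decreasing sequence `μ` tending
to zero, with respect to the capacity giving each set of `n` indices the mass `α n`. -/
noncomputable def choquetSum (α : ℕ → ℝ≥0) (μ : ℕ → ℝ) : ℝ≥0∞ :=
  ∑' k : ℕ, ENNReal.ofReal (μ k - μ (k + 1)) * (α (k + 1) : ℝ≥0∞)

theorem choquetSum_add (α : ℕ → ℝ≥0) {μ ν : ℕ → ℝ} (hμ : Antitone μ) (hν : Antitone ν) :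
    choquetSum α (μ + ν) = choquetSum α μ + choquetSum α ν := by
  simp only [choquetSum, ← ENNReal.tsum_add, ← add_mul, Pi.add_apply, add_sub_add_comm,
    ENNReal.ofReal_add (sub_nonneg.2 (hμ (Nat.le_succ _))) (sub_nonneg.2 (hν (Nat.le_succ _)))]

theorem choquetSum_indicator_Iio {α : ℕ → ℝ≥0} (h0 : α 0 = 0) (n : ℕ) :
    choquetSum α ((Set.Iio n).indicator 1) = α n := by
  cases n with
  | zero => simp [choquetSum, h0]
  | succ n =>
    rw [choquetSum, tsum_eq_single n]
    · simp
    · intro k hk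
      rcases hk.lt_or_gt with h | h
      · simp [h, h.trans n.lt_succ_self]
      · simp [h.not_gt, h.not_ge]

theorem tsum_ofReal_sub_succ {μ : ℕ → ℝ} (hμ : Antitone μ)
    (hμ0 : Filter.Tendsto μ Filter.atTop (nhds 0)) :
    ∑' k, ENNReal.ofReal (μ k - μ (k + 1)) = ENNReal.ofReal (μ 0) := by
  have hpartial (n : ℕ) :
      ∑ k ∈ Finset.range n, ENNReal.ofReal (μ k - μ (k + 1)) = ENNReal.ofReal (μ 0 - μ n) := by
    rw [← ENNReal.ofReal_sum_of_nonneg fun k _ => sub_nonneg.2 (hμ k.le_succ),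
      Finset.sum_range_sub']
  refine tendsto_nhds_unique (ENNReal.tendsto_nat_tsum _) ?_
  simpa only [hpartial, sub_zero] using ENNReal.tendsto_ofReal (hμ0.const_sub (μ 0))

theorem tsum_sum_range_succ_mul (c d : ℕ → ℝ≥0∞) :
    ∑' k, (∑ i ∈ Finset.range (k + 1), c i) * d k = ∑' i, c i * ∑' j, d (i + j) := calc
  ∑' k, (∑ i ∈ Finset.range (k + 1), c i) * d k =
      ∑' k, ∑ p ∈ Finset.HasAntidiagonal.antidiagonal k, c p.1 * d (p.1 + p.2) := by
    refine tsum_congr fun k => ?_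
    rw [Finset.Nat.sum_antidiagonal_eq_sum_range_succ fun i j => c i * d (i + j), Finset.sum_mul]
    exact Finset.sum_congr rfl fun i hi => by
      rw [Nat.add_sub_cancel' (Nat.lt_succ_iff.1 (Finset.mem_range.1 hi))]
  _ = ∑' p : Σ k : ℕ, Finset.HasAntidiagonal.antidiagonal k, c p.2.1.1 * d (p.2.1.1 + p.2.1.2) := by
    rw [ENNReal.tsum_sigma']
    exact tsum_congr fun k => (Finset.tsum_subtype _ fun p : ℕ × ℕ => c p.1 * d (p.1 + p.2)).symm
  _ = ∑' p : ℕ × ℕ, c p.1 * d (p.1 + p.2) :=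
    Finset.HasAntidiagonal.sigmaAntidiagonalEquivProd.tsum_eq fun p => c p.1 * d (p.1 + p.2)
  _ = ∑' i, c i * ∑' j, d (i + j) := by
    rw [ENNReal.tsum_prod (f := fun i j => c i * d (i + j))]
    exact tsum_congr fun i => ENNReal.tsum_mul_left

theorem increment_succ (α : ℕ → ℝ≥0) (k : ℕ) : increment α (k + 1) = α (k + 1) - α k := rfl

theorem increment_succ_nonneg {α : ℕ → ℝ≥0} (hα : Monotone α) (k : ℕ) :
    0 ≤ increment α (k + 1) :=
  sub_nonneg.2 (NNReal.coe_le_coe.2 (hα k.le_succ))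

theorem sum_range_ofReal_increment {α : ℕ → ℝ≥0} (hα : Monotone α) (h0 : α 0 = 0) (n : ℕ) :
    ∑ k ∈ Finset.range n, ENNReal.ofReal (increment α (k + 1)) = α n := by
  rw [← ENNReal.ofReal_sum_of_nonneg fun k _ => increment_succ_nonneg hα k]
  simp only [increment_succ, Finset.sum_range_sub fun k => (α k : ℝ), h0, NNReal.coe_zero, sub_zero,
    ENNReal.ofReal_coe_nnreal]

theorem choquetSum_eq_tsum_increment_mul {α : ℕ → ℝ≥0} (hα : Monotone α) (h0 : α 0 = 0)
    {μ : ℕ → ℝ} (hμ : Antitone μ) (hμ0 : Filter.Tendsto μ Filter.atTop (nhds 0)) :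
    choquetSum α μ = ∑' k, ENNReal.ofReal (increment α (k + 1) * μ k) := by
  have htail (i : ℕ) :
      ∑' j, ENNReal.ofReal (μ (i + j) - μ (i + j + 1)) = ENNReal.ofReal (μ i) :=
    tsum_ofReal_sub_succ (μ := fun j => μ (i + j)) (fun _ _ h => hμ (Nat.add_le_add_left h i))
      (hμ0.comp (Filter.tendsto_atTop_mono (Nat.le_add_left · i) Filter.tendsto_id))
  simp only [choquetSum, ← sum_range_ofReal_increment hα h0]
  simp only [mul_comm (ENNReal.ofReal (μ _ - _)),
    tsum_sum_range_succ_mul _ fun k => ENNReal.ofReal (μ k - μ (k + 1)), htail,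
    ENNReal.ofReal_mul (increment_succ_nonneg hα _)]

theorem mul_sum_sub_sum_le {c x y : ℕ → ℝ} (hc : Antitone c)
    (hxy : ∀ n, ∑ k ∈ Finset.range n, x k ≤ ∑ k ∈ Finset.range n, y k) (n : ℕ) :
    c n * (∑ k ∈ Finset.range n, y k - ∑ k ∈ Finset.range n, x k) ≤
      ∑ k ∈ Finset.range n, c k * y k - ∑ k ∈ Finset.range n, c k * x k := by
  induction n with
  | zero => simp
  | succ n ih =>
    refine (mul_le_mul_of_nonneg_right (hc n.le_succ) (sub_nonneg.2 (hxy (n + 1)))).trans ?_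
    simp only [Finset.sum_range_succ]
    linarith

theorem tsum_ofReal_mul_le_of_sum_range_le {c x y : ℕ → ℝ} (hc : Antitone c) (hc0 : ∀ k, 0 ≤ c k)
    (hx : ∀ k, 0 ≤ x k) (hy : ∀ k, 0 ≤ y k)
    (hxy : ∀ n, ∑ k ∈ Finset.range n, x k ≤ ∑ k ∈ Finset.range n, y k) :
    ∑' k, ENNReal.ofReal (c k * x k) ≤ ∑' k, ENNReal.ofReal (c k * y k) := by
  have hfinite (n : ℕ) :
      ∑ k ∈ Finset.range n, c k * x k ≤ ∑ k ∈ Finset.range n, c k * y k :=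
    sub_nonneg.1 <| (mul_nonneg (hc0 n) (sub_nonneg.2 (hxy n))).trans (mul_sum_sub_sum_le hc hxy n)
  refine ENNReal.tsum_le_of_sum_range_le fun n => ?_
  calc ∑ k ∈ Finset.range n, ENNReal.ofReal (c k * x k)
      = ENNReal.ofReal (∑ k ∈ Finset.range n, c k * x k) :=
        (ENNReal.ofReal_sum_of_nonneg fun k _ => mul_nonneg (hc0 k) (hx k)).symm
    _ ≤ ENNReal.ofReal (∑ k ∈ Finset.range n, c k * y k) := ENNReal.ofReal_le_ofReal (hfinite n)
    _ = ∑ k ∈ Finset.range n, ENNReal.ofReal (c k * y k) :=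
        ENNReal.ofReal_sum_of_nonneg fun k _ => mul_nonneg (hc0 k) (hy k)
    _ ≤ ∑' k, ENNReal.ofReal (c k * y k) := ENNReal.sum_le_tsum _

theorem isConcaveSeq_iff_add_le {α : ℕ → ℝ≥0} :
    IsConcaveSeq α ↔ ∀ n, α n + α (n + 2) ≤ α (n + 1) + α (n + 1) := by
  refine ⟨fun h n => ?_, fun h i hi => ?_⟩
  · have := h (n + 1) n.succ_pos
    rw [Nat.add_sub_cancel] at this
    rw [← NNReal.coe_le_coe]
    push_cast
    linarith
  · obtain ⟨n, rfl⟩ := Nat.exists_eq_add_of_le' hi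
    have := NNReal.coe_le_coe.2 (h n)
    push_cast at this
    rw [Nat.add_sub_cancel]
    linarith

theorem isConcaveSeq_iff_antitone_increment {α : ℕ → ℝ≥0} :
    IsConcaveSeq α ↔ Antitone fun k => increment α (k + 1) := by
  rw [isConcaveSeq_iff_add_le]
  refine ⟨fun h => antitone_nat_of_succ_le fun n => ?_, fun h n => ?_⟩
  · have := NNReal.coe_le_coe.2 (h n)
    push_cast at this
    rw [increment_succ, increment_succ]
    linarith
  · have := h n.le_succ
    simp only [increment_succ] at this
    rw [← NNReal.coe_le_coe]
    push_cast
    linarith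

theorem antitoneOn_increment_iff {α : ℕ → ℝ≥0} :
    AntitoneOn (increment α) (Set.Ici 1) ↔ Antitone fun k => increment α (k + 1) := by
  refine ⟨fun h i j hij => h (Set.mem_Ici.2 i.succ_pos) (Set.mem_Ici.2 j.succ_pos)
    (Nat.succ_le_succ hij), fun h i hi j hj hij => ?_⟩
  obtain ⟨i, rfl⟩ := Nat.exists_eq_add_of_le' hi
  obtain ⟨j, rfl⟩ := Nat.exists_eq_add_of_le' hj
  exact h (Nat.le_of_succ_le_succ hij)

theorem monotone_of_antitone_increment {α : ℕ → ℝ≥0}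
    (hα : Antitone fun k => increment α (k + 1)) : Monotone α := by
  refine monotone_nat_of_le_succ fun n => ?_
  by_contra! hlt
  have hstep_neg : 0 < -increment α (n + 1) := by
    rw [increment_succ, neg_sub]
    exact sub_pos.2 (NNReal.coe_lt_coe.2 hlt)
  have hdecay (k : ℕ) : (α (n + k) : ℝ) ≤ α n - k * -increment α (n + 1) := by
    induction k with
    | zero => simp
    | succ k ih =>
      have := hα (Nat.le_add_right n k)
      simp only [increment_succ α (n + k)] at this
      push_cast
      rw [← add_assoc]
      linarith
  obtain ⟨k, hk⟩ := exists_lt_nsmul hstep_neg (α n : ℝ)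
  rw [nsmul_eq_mul] at hk
  linarith [hdecay k, (α (n + k)).coe_nonneg]

end Sequences

section ChoquetNorm

variable {H : Type*} [NormedAddCommGroup H] [InnerProductSpace ℂ H]

theorem IsEigenSequence.choquetTrace_eq {A : H →L[ℂ] H} {e : ℕ → H} {μ : ℕ → ℝ}
    (h : IsEigenSequence A e μ) (hA : (A : H →ₗ[ℂ] H).IsSymmetric) (α : ℕ → ℝ≥0) :
    choquetTrace α A = choquetSum α μ := by
  rw [choquetTrace, h.eigenvalueSeq_eq hA, choquetSum]

variable [CompleteSpace H]

theorem choquetNorm_of_isPositive (α : ℕ → ℝ≥0) {A : H →L[ℂ] H} (hA : A.IsPositive) :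
    choquetNorm α A = choquetTrace α A := by
  rw [choquetNorm, CFC.abs_of_nonneg A ((A.nonneg_iff_isPositive).2 hA)]

theorem exists_isEigenSequence_abs (hH : ¬ FiniteDimensional ℂ H) {a : H →L[ℂ] H}
    (ha : IsCompactOperator a) {α : ℕ → ℝ≥0} (hα : Monotone α) (h0 : α 0 = 0) :
    ∃ e μ, IsEigenSequence (CFC.abs a) e μ ∧
      choquetNorm α a = ∑' k, ENNReal.ofReal (increment α (k + 1) * μ k) := by
  obtain ⟨e, μ, h⟩ := exists_isEigenSequence hH (isCompactOperator_abs ha) (isPositive_abs a)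
  refine ⟨e, μ, h, (h.choquetTrace_eq (isPositive_abs a).isSymmetric α).trans ?_⟩
  exact choquetSum_eq_tsum_increment_mul hα h0 h.antitone
    (h.tendsto_zero (isCompactOperator_abs ha))

theorem choquetNorm_add_le (hH : ¬ FiniteDimensional ℂ H) {α : ℕ → ℝ≥0} (h0 : α 0 = 0)
    (hα : Antitone fun k => increment α (k + 1)) {a b : H →L[ℂ] H}
    (ha : IsCompactOperator a) (hb : IsCompactOperator b) :
    choquetNorm α (a + b) ≤ choquetNorm α a + choquetNorm α b := by
  have hmono : Monotone α := monotone_of_antitone_increment hα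
  have hab : IsCompactOperator (a + b) := ha.add hb
  obtain ⟨e, μ, hμ, hab_eq⟩ := exists_isEigenSequence_abs hH hab hmono h0
  obtain ⟨f, ν, hν, ha_eq⟩ := exists_isEigenSequence_abs hH ha hmono h0
  obtain ⟨g, ρ, hρ, hb_eq⟩ := exists_isEigenSequence_abs hH hb hmono h0
  calc choquetNorm α (a + b) = ∑' k, ENNReal.ofReal (increment α (k + 1) * μ k) := hab_eq
    _ ≤ ∑' k, ENNReal.ofReal (increment α (k + 1) * (ν + ρ) k) :=
      tsum_ofReal_mul_le_of_sum_range_le hα (increment_succ_nonneg hmono) hμ.nonneg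
        (fun k => add_nonneg (hν.nonneg k) (hρ.nonneg k)) (hμ.sum_range_le_add hν hρ)
    _ = choquetNorm α a + choquetNorm α b := by
      rw [ha_eq, hb_eq, ← ENNReal.tsum_add]
      refine tsum_congr fun k => ?_
      have hinc := increment_succ_nonneg hmono k
      rw [Pi.add_apply, mul_add, ENNReal.ofReal_add (mul_nonneg hinc (hν.nonneg k))
        (mul_nonneg hinc (hρ.nonneg k))]

theorem choquetNorm_initialProjection {e : ℕ → H} (he : Orthonormal ℂ e) {α : ℕ → ℝ≥0}
    (h0 : α 0 = 0) (n : ℕ) : choquetNorm α (initialProjection e n) = α n := by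
  have hpos := isPositive_initialProjection e n
  rw [choquetNorm_of_isPositive α hpos,
    (isEigenSequence_initialProjection he n).choquetTrace_eq hpos.isSymmetric,
    choquetSum_indicator_Iio h0]

theorem choquetNorm_initialProjection_add {e : ℕ → H} (he : Orthonormal ℂ e) {α : ℕ → ℝ≥0}
    (h0 : α 0 = 0) (m n : ℕ) :
    choquetNorm α (initialProjection e m + initialProjection e n) = α m + α n := by
  have hpos := (isPositive_initialProjection e m).add (isPositive_initialProjection e n)
  have hm := isEigenSequence_initialProjection he m
  have hn := isEigenSequence_initialProjection he n
  rw [choquetNorm_of_isPositive α hpos, (hm.add hn).choquetTrace_eq hpos.isSymmetric,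
    choquetSum_add α hm.antitone hn.antitone, choquetSum_indicator_Iio h0,
    choquetSum_indicator_Iio h0]

theorem isConcaveSeq_of_choquetNorm_add_le (hH : ¬ FiniteDimensional ℂ H) {α : ℕ → ℝ≥0}
    (h0 : α 0 = 0)
    (hadd : ∀ a b : H →L[ℂ] H, IsCompactOperator a → IsCompactOperator b →
      choquetNorm α (a + b) ≤ choquetNorm α a + choquetNorm α b) : IsConcaveSeq α := by
  obtain ⟨e, he⟩ := exists_orthonormal_nat hH
  refine isConcaveSeq_iff_add_le.2 fun n => ?_
  have hle := hadd _ _ (isCompactOperator_initialProjection e (n + 1))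
    (isCompactOperator_initialProjection (e ∘ Equiv.swap n (n + 1)) (n + 1))
  rw [initialProjection_add_initialProjection_swap, choquetNorm_initialProjection_add he h0,
    choquetNorm_initialProjection he h0,
    choquetNorm_initialProjection (he.comp _ (Equiv.injective _)) h0] at hle
  exact_mod_cast hle

end ChoquetNorm

end ChoquetTrace

theorem mainTheorem7_general {H : Type*} [NormedAddCommGroup H] [InnerProductSpace ℂ H]
    [CompleteSpace H] (hH : ¬ FiniteDimensional ℂ H) (α : ℕ → ℝ≥0) (h0 : α 0 = 0) :
    List.TFAE
      [ChoquetTrace.IsConcaveSeq α,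
       AntitoneOn (ChoquetTrace.increment α) (Set.Ici 1),
       ∀ a b : H →L[ℂ] H, IsCompactOperator a → IsCompactOperator b →
         ChoquetTrace.choquetNorm α (a + b) ≤
           ChoquetTrace.choquetNorm α a + ChoquetTrace.choquetNorm α b] := by
  tfae_have 1 ↔ 2 := ChoquetTrace.isConcaveSeq_iff_antitone_increment.trans
    ChoquetTrace.antitoneOn_increment_iff.symm
  tfae_have 2 → 3 := fun hα _ _ ha hb =>
    ChoquetTrace.choquetNorm_add_le hH h0 (ChoquetTrace.antitoneOn_increment_iff.1 hα) ha hb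
  tfae_have 3 → 1 := ChoquetTrace.isConcaveSeq_of_choquetNorm_add_le hH h0
  tfae_finish

theorem mainTheorem7 {H : Type*} [NormedAddCommGroup H] [InnerProductSpace ℂ H] [CompleteSpace H]
    [TopologicalSpace.SeparableSpace H] (hH : ¬ FiniteDimensional ℂ H)
    (α : ℕ → ℝ≥0) (hmono : Monotone α) (h0 : α 0 = 0) (h1 : 0 < α 1) :
    List.TFAE
      [ChoquetTrace.IsConcaveSeq α,
       AntitoneOn (ChoquetTrace.increment α) (Set.Ici 1),
       ∀ a b : H →L[ℂ] H, IsCompactOperator a → IsCompactOperator b →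
         ChoquetTrace.choquetNorm α (a + b) ≤
           ChoquetTrace.choquetNorm α a + ChoquetTrace.choquetNorm α b] :=
  mainTheorem7_general hH α h0
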